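/- Consider a networked ISAC downlink with $L$ transmitters of $N_t$ antennas each ($N=LN_t$ antennas in total) and $K$ single-antenna users. Let $\mathbf h_k\in\mathbb C^N$ be the channel of user $k$, $\Gamma_k>0$ its required SINR, $\sigma_v^2>0$ the noise power, $C^{dl}>0$ the downlink fronthaul capacity, $g_l\in\mathbb C$ the target path coefficient and $\theta_{t,l}\in\mathbb R$ the direction of departure at transmitter $l$. Put $\widetilde\Gamma_k=1+1/\Gamma_k$, $\alpha=1/(2^{C^{dl}}-1)$, $\mathbf H_k=\mathbf h_k\mathbf h_k^{\mathsf H}$, $\mathbf A_k=\mathbf H_k+\alpha\,\mathrm{diag}(\mathbf H_k)$, $\boldsymbol\Sigma_g=\mathrm{diag}(g_1,\dots,g_L)\otimes\mathbf I_{N_t}$, $\mathbf B=\boldsymbol\Sigma_g^{\mathsf H}\big(\mathbf a_t\mathbf a_t^{\mathsf H}+\tfrac{\alpha}{N_t}\mathbf I\big)\boldsymbol\Sigma_g$, where $\mathbf a_t\in\mathbb C^N$ has, in the block of transmitter $l$, the entries $N_t^{-1/2}e^{-j\pi n\cos\theta_{t,l}}$, $0\le n<N_t$. Fix $\lambda\ge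 0$ and let $\mathbf C(\lambda,\boldsymbol\mu)=\mathbf I-\lambda\mathbf B+\sum_{i=1}^K\mu_i\mathbf A_i$. Consider $$\text{(D1.1)}\quad \mathcal L_{min}(\lambda)=\inf_{\mathbf w_1,\dots,\mathbf w_K\in\mathbb C^N}\ \sum_{k=1}^K\mathbf w_k^{\mathsf H}(\mathbf I-\lambda\mathbf B)\mathbf w_k\quad\text{s.t.}\quad \widetilde\Gamma_k\mathbf w_k^{\mathsf H}\mathbf H_k\mathbf w_k\ \ge\ \sum_{i=1}^K\mathbf w_i^{\mathsf H}\mathbf A_k\mathbf w_i+\sigma_v^2\quad\text{for all }k,$$ $$\text{(D2)}\quad \max_{\mu_1,\dots,\mu_K\ge 0}\ \sum_{k=1}^K\mu_k\sigma_v^2\quad\text{s.t.}\quad \mu_k\ \le\ m_k(\boldsymbol\mu):=\inf_{\|\mathbf u\|=1,\ \mathbf h_k^{\mathsf H}\mathbf u\ne 0}\ \frac{\mathbf u^{\mathsf H}\mathbf C(\lambda,\boldsymbol\mu)\mathbf u}{\widetilde\Gamma_k\,\mathbf u^{\mathsf H}\mathbf H_k\mathbf u}\quad\text{for all }k.$$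 Suppose that (D1.1) and (D2) are both feasible. Then: 1. The optimal values of (D1.1) (as an infimum) and of (D2) are finite and equal, and the maximum in (D2) is attained. 2. If $(\mathbf w_k^*)$ is an optimal solution of (D1.1) and $\boldsymbol\mu^*$ an optimal solution of (D2), then for every $k$: $\mathbf w_k^*\ne 0$, the direction $\mathbf w_k^*/\|\mathbf w_k^*\|$ attains the infimum $m_k(\boldsymbol\mu^*)$, and $\mu_k^*=m_k(\boldsymbol\mu^*)$. 3. Conversely, if (D1.1) has an optimal solution and $\boldsymbol\mu^*$ is an optimal solution of (D2) with $\mathbf C(\lambda,\boldsymbol\mu^*)\succ 0$, then for every choice of unit vectors $\mathbf u_k$ attaining $m_k(\boldsymbol\mu^*)$, $k=1,\dots,K$, there are powers $p_k>0$ such that $(\sqrt{p_k}\,\mathbf u_k)_k$ is an optimal solution of (D1.1). 4. If (D2) is strictly feasible, i.e. some $\boldsymbol\mu\ge 0$ satisfies $\mathbf C(\lambda,\boldsymbol\mu)\succ 0$ and $\mu_k<m_k(\boldsymbol\mu)$ for all $k$, then (D1.1) has an optimal solution, and $\mathbf C(\lambda,\boldsymbol\mu^*)\succ 0$ for every optimal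 solution $\boldsymbol\mu^*$ of (D2). -/

import Mathlib

open scoped Matrix Kronecker ComplexOrder

namespace ISAC

/-- The data of the downlink of a networked ISAC system with `L` transmitters of `Nt` antennas
each and `K` single-antenna users. The antennas are indexed by `Fin L × Fin Nt`. -/
structure System (L Nt K : ℕ) where
  /-- channel `h_k` between the transmitters and user `k` -/
  h : Fin K → (Fin L × Fin Nt → ℂ)
  /-- path coefficient of the `l`-th transmitter-target-receiver channel -/
  g : Fin L → ℂ
  /-- direction of departure at the `l`-th transmitter -/
  θ : Fin L → ℝ
  /-- required communication SINR of user `k` -/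
  Γ : Fin K → ℝ
  /-- capacity (in bits) of the downlink fronthaul links -/
  Cdl : ℝ
  /-- standard deviation of the noise at the users -/
  σv : ℝ
  Γ_pos : ∀ k, 0 < Γ k
  Cdl_pos : 0 < Cdl
  σv_pos : 0 < σv

/-- The Hermitian form `xᴴ M x`; its value is real for Hermitian `M`, the only case used. -/
noncomputable def hform {ι : Type*} [Fintype ι] (M : Matrix ι ι ℂ) (x : EuclideanSpace ℂ ι) : ℝ :=
  (star x.ofLp ⬝ᵥ M *ᵥ x.ofLp).re

namespace System

variable {L Nt K : ℕ} (S : System L Nt K)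

/-- `α = 1 / (2 ^ Cdl - 1)`. -/
noncomputable def α : ℝ := 1 / ((2 : ℝ) ^ S.Cdl - 1)

/-- `Γ̃_k = 1 + 1 / Γ_k`. -/
noncomputable def Γt (k : Fin K) : ℝ := 1 + 1 / S.Γ k

/-- The stacked transmit steering vector `a_t`. -/
noncomputable def steering : Fin L × Fin Nt → ℂ := fun p =>
  (Real.sqrt (1 / (Nt : ℝ)) : ℂ) *
    Complex.exp (-(Complex.I * (Real.pi : ℂ) * ((p.2 : ℕ) : ℂ) * (Real.cos (S.θ p.1) : ℂ)))

/-- `Σ_g = diag(g_1, …, g_L) ⊗ I`. -/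
noncomputable def Sg : Matrix (Fin L × Fin Nt) (Fin L × Fin Nt) ℂ :=
  Matrix.diagonal S.g ⊗ₖ (1 : Matrix (Fin Nt) (Fin Nt) ℂ)

/-- `H_k = h_k h_kᴴ`. -/
noncomputable def H (k : Fin K) : Matrix (Fin L × Fin Nt) (Fin L × Fin Nt) ℂ :=
  Matrix.vecMulVec (S.h k) (star (S.h k))

/-- `A_k = H_k + α diag(H_k)`. -/
noncomputable def A (k : Fin K) : Matrix (Fin L × Fin Nt) (Fin L × Fin Nt) ℂ :=
  S.H k + S.α • Matrix.diagonal (S.H k).diag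

/-- `B = Σ_gᴴ (a_t a_tᴴ + (α / Nt) I) Σ_g`. -/
noncomputable def B : Matrix (Fin L × Fin Nt) (Fin L × Fin Nt) ℂ :=
  S.Sgᴴ * (Matrix.vecMulVec S.steering (star S.steering) + (S.α / (Nt : ℝ)) • 1) * S.Sg

/-- `C(λ, μ) = I - λ B + ∑ i, μ_i A_i`. -/
noncomputable def C (lam : ℝ) (μ : Fin K → ℝ) : Matrix (Fin L × Fin Nt) (Fin L × Fin Nt) ℂ :=
  1 - lam • S.B + ∑ i, μ i • S.A i

/-! ### The inner (primal) problem -/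

/-- The beamformers `w_1, …, w_K` satisfy all the communication constraints. -/
def PrimalFeasible (w : Fin K → EuclideanSpace ℂ (Fin L × Fin Nt)) : Prop :=
  ∀ k, S.Γt k * hform (S.H k) (w k) ≥ ∑ i, hform (S.A k) (w i) + S.σv ^ 2

/-- `∑ k, w_kᴴ (I - λ B) w_k`. -/
noncomputable def primalObj (lam : ℝ) (w : Fin K → EuclideanSpace ℂ (Fin L × Fin Nt)) : ℝ :=
  ∑ k, hform (1 - lam • S.B) (w k)

/-- `w` is an optimal solution of the inner problem. -/
def IsPrimalOptimal (lam : ℝ) (w : Fin K → EuclideanSpace ℂ (Fin L × Fin Nt)) : Prop :=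
  S.PrimalFeasible w ∧ ∀ w', S.PrimalFeasible w' → S.primalObj lam w ≤ S.primalObj lam w'

/-! ### The dual problem -/

/-- The generalized Rayleigh quotient `(uᴴ C(λ, μ) u) / (Γ̃_k uᴴ H_k u)`. -/
noncomputable def rayleigh (lam : ℝ) (μ : Fin K → ℝ) (k : Fin K)
    (u : EuclideanSpace ℂ (Fin L × Fin Nt)) : ℝ :=
  hform (S.C lam μ) u / (S.Γt k * hform (S.H k) u)

/-- The unit vectors at which the quotient of user `k` is defined. -/
def directions (k : Fin K) : Set (EuclideanSpace ℂ (Fin L × Fin Nt)) :=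
  {u | ‖u‖ = 1 ∧ hform (S.H k) u ≠ 0}

/-- The minimum of the generalized Rayleigh quotient of user `k`, as an infimum in the extended
reals (`-∞` if the quotient is unbounded below). -/
noncomputable def minRayleigh (lam : ℝ) (μ : Fin K → ℝ) (k : Fin K) : EReal :=
  ⨅ u ∈ S.directions k, (S.rayleigh lam μ k u : EReal)

/-- The unit vector `u` attains the minimum of the generalized Rayleigh quotient of user `k`. -/
def IsMinDirection (lam : ℝ) (μ : Fin K → ℝ) (k : Fin K)
    (u : EuclideanSpace ℂ (Fin L × Fin Nt)) : Prop :=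
  u ∈ S.directions k ∧ (S.rayleigh lam μ k u : EReal) = S.minRayleigh lam μ k

/-- Feasibility for the dual problem. -/
def DualFeasible (lam : ℝ) (μ : Fin K → ℝ) : Prop :=
  (∀ k, 0 ≤ μ k) ∧ ∀ k, (μ k : EReal) ≤ S.minRayleigh lam μ k

/-- Strict feasibility for the dual problem. -/
def DualStrictlyFeasible (lam : ℝ) (μ : Fin K → ℝ) : Prop :=
  (∀ k, 0 ≤ μ k) ∧ (S.C lam μ).PosDef ∧ ∀ k, (μ k : EReal) < S.minRayleigh lam μ k

/-- `∑ k, μ_k σ_v²`. -/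
noncomputable def dualObj (μ : Fin K → ℝ) : ℝ := ∑ k, μ k * S.σv ^ 2

/-- `μ` is an optimal solution of the dual problem. -/
def IsDualOptimal (lam : ℝ) (μ : Fin K → ℝ) : Prop :=
  S.DualFeasible lam μ ∧ ∀ μ', S.DualFeasible lam μ' → S.dualObj μ' ≤ S.dualObj μ

end System

end ISAC

/-! Since every `h k` is nonzero, dual feasibility says that `μ ≥ 0` and the forms of `dualMatrix`,
M_k = C(λ, μ) - μ_k Γ̃_k H_k, are nonnegative. The Lagrangian identity `primalObj_eq_dualObj_add`
writes the duality gap as the forms M_k at w_k plus multipliers times slacks. This yields weak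
duality and, at zero gap, M_k vanishes at w_k.

C is increasing in μ, so the dual feasible set is closed under maxima and a dual optimum is its
greatest point. There each M_k has a nonzero zero u_k, otherwise μ_k could grow. If some dual
feasible ν makes all M_k positive definite, the SINR equations for powers along the u_k form a
transposed Z-matrix system. The Z-matrix maps μ - ν ≥ 0 to a positive vector, so nonnegative powers
solve it, all constraints are tight and the gap is zero (`exists_primalFeasible_eq`).

In general, (sλ, sμ) with s < 1 turns M_k into (1 - s)I + s M_k, which is positive definite. So the
gap vanishes at sλ, and compactness of the dual points lets s → 1 (`strong_duality`). -/

namespace ISAC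

/-! ### Hermitian forms: algebra, compactness bounds, positivity -/

section HermitianForm

variable {ι : Type*} [Fintype ι]

theorem hform_add (M M' : Matrix ι ι ℂ) (x : EuclideanSpace ℂ ι) :
    hform (M + M') x = hform M x + hform M' x := by
  simp [hform, Matrix.add_mulVec]

theorem hform_sub (M M' : Matrix ι ι ℂ) (x : EuclideanSpace ℂ ι) :
    hform (M - M') x = hform M x - hform M' x := by
  simp [hform, Matrix.sub_mulVec]

theorem hform_smul (c : ℝ) (M : Matrix ι ι ℂ) (x : EuclideanSpace ℂ ι) :
    hform (c • M) x = c * hform M x := by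
  simp [hform, Matrix.smul_mulVec]

theorem hform_zero (x : EuclideanSpace ℂ ι) : hform (0 : Matrix ι ι ℂ) x = 0 := by
  simp [hform]

theorem hform_sum {κ : Type*} (s : Finset κ) (M : κ → Matrix ι ι ℂ) (x : EuclideanSpace ℂ ι) :
    hform (∑ i ∈ s, M i) x = ∑ i ∈ s, hform (M i) x := by
  classical
  induction s using Finset.induction_on with
  | empty => simp [hform_zero]
  | insert a s ha ih => rw [Finset.sum_insert ha, Finset.sum_insert ha, hform_add, ih]

theorem hform_one [DecidableEq ι] (x : EuclideanSpace ℂ ι) : hform 1 x = ‖x‖ ^ 2 := by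
  rw [EuclideanSpace.norm_sq_eq]
  simp [hform, dotProduct, ← Complex.normSq_eq_norm_sq, Complex.normSq_apply]

theorem hform_diagonal [DecidableEq ι] (d : ι → ℂ) (x : EuclideanSpace ℂ ι) :
    hform (Matrix.diagonal d) x = ∑ i, (d i).re * ‖x i‖ ^ 2 := by
  simp only [hform, dotProduct, Matrix.mulVec_diagonal, Complex.re_sum, Pi.star_apply,
    RCLike.star_def, ← Complex.normSq_eq_norm_sq, Complex.normSq_apply]
  refine Finset.sum_congr rfl fun i _ => ?_
  simp
  ring

theorem hform_vecMulVec (v : ι → ℂ) (x : EuclideanSpace ℂ ι) :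
    hform (Matrix.vecMulVec v (star v)) x = ‖star v ⬝ᵥ x.ofLp‖ ^ 2 := by
  have h : star x.ofLp ⬝ᵥ v = star (star v ⬝ᵥ x.ofLp) := by
    rw [Matrix.star_dotProduct]
  rw [hform, Matrix.vecMulVec_mulVec, dotProduct_smul, h, ← Complex.normSq_eq_norm_sq,
    Complex.normSq_apply]
  simp

theorem hform_smul_vec (M : Matrix ι ι ℂ) (c : ℂ) (x : EuclideanSpace ℂ ι) :
    hform M (c • x) = ‖c‖ ^ 2 * hform M x := by
  simp only [hform, WithLp.ofLp_smul, Matrix.mulVec_smul, star_smul, smul_dotProduct,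
    dotProduct_smul, smul_eq_mul, ← mul_assoc]
  rw [RCLike.star_def, Complex.mul_conj', ← Complex.ofReal_pow, Complex.re_ofReal_mul]

theorem hform_real_smul_vec (M : Matrix ι ι ℂ) (c : ℝ) (x : EuclideanSpace ℂ ι) :
    hform M (c • x) = c ^ 2 * hform M x := by
  have h : c • x = (c : ℂ) • x := by ext i; simp
  rw [h, hform_smul_vec]
  simp

theorem hform_zero_vec (M : Matrix ι ι ℂ) : hform M 0 = 0 := by
  simp [hform]

theorem hform_parallelogram (M : Matrix ι ι ℂ) (x y : EuclideanSpace ℂ ι) :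
    hform M (x + y) + hform M (x - y) = 2 * hform M x + 2 * hform M y := by
  simp only [hform, WithLp.ofLp_add, WithLp.ofLp_sub, Matrix.mulVec_add, Matrix.mulVec_sub,
    star_add, star_sub, add_dotProduct, sub_dotProduct, dotProduct_add, dotProduct_sub,
    Complex.add_re, Complex.sub_re]
  ring

theorem continuous_hform (M : Matrix ι ι ℂ) : Continuous (hform M) := by
  unfold hform
  exact Complex.continuous_re.comp (Continuous.dotProduct
    (PiLp.continuous_ofLp 2 _).star (Continuous.matrix_mulVec continuous_const
      (PiLp.continuous_ofLp 2 _)))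

theorem hform_eq_norm_sq_mul (M : Matrix ι ι ℂ) {x : EuclideanSpace ℂ ι} (hx : x ≠ 0) :
    hform M x = ‖x‖ ^ 2 * hform M (‖x‖⁻¹ • x) := by
  have : ‖x‖ ≠ 0 := norm_ne_zero_iff.mpr hx
  rw [hform_real_smul_vec]
  field_simp

/-- The zeros of a nonnegative form are closed under addition. -/
theorem hform_add_eq_zero {M : Matrix ι ι ℂ} (hM : ∀ x, 0 ≤ hform M x)
    {x y : EuclideanSpace ℂ ι} (hx : hform M x = 0) (hy : hform M y = 0) :
    hform M (x + y) = 0 := by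
  have := hform_parallelogram M x y
  linarith [hM (x + y), hM (x - y)]

theorem exists_hform_le (M : Matrix ι ι ℂ) :
    ∃ c : ℝ, 0 ≤ c ∧ ∀ x, hform M x ≤ c * ‖x‖ ^ 2 := by
  obtain ⟨c, hc⟩ := (isCompact_sphere (0 : EuclideanSpace ℂ ι) 1).bddAbove_image
    (continuous_hform M).continuousOn
  refine ⟨max c 0, le_max_right _ _, fun x => ?_⟩
  rcases eq_or_ne x 0 with rfl | hx
  · simp [hform_zero_vec]
  · rw [hform_eq_norm_sq_mul M hx, mul_comm]
    gcongr
    refine (hc ⟨_, ?_, rfl⟩).trans (le_max_left _ _)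
    simp [norm_smul, hx]

theorem exists_le_hform {M : Matrix ι ι ℂ} (hM : ∀ x, x ≠ 0 → 0 < hform M x) :
    ∃ ε : ℝ, 0 < ε ∧ ∀ x, ε * ‖x‖ ^ 2 ≤ hform M x := by
  rcases (Metric.sphere (0 : EuclideanSpace ℂ ι) 1).eq_empty_or_nonempty with h | h
  · refine ⟨1, one_pos, fun x => ?_⟩
    rcases eq_or_ne x 0 with rfl | hx
    · simp [hform_zero_vec]
    · have : ‖x‖⁻¹ • x ∈ Metric.sphere (0 : EuclideanSpace ℂ ι) 1 := by simp [norm_smul, hx]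
      simp [h] at this
  · obtain ⟨y, hy, hmin⟩ := (isCompact_sphere (0 : EuclideanSpace ℂ ι) 1).exists_isMinOn h
      (continuous_hform M).continuousOn
    refine ⟨hform M y, hM y (Metric.ne_of_mem_sphere hy one_ne_zero), fun x => ?_⟩
    rcases eq_or_ne x 0 with rfl | hx
    · simp [hform_zero_vec]
    · rw [hform_eq_norm_sq_mul M hx, mul_comm]
      gcongr
      exact hmin (by simp [norm_smul, hx])

theorem posDef_iff_hform_pos {M : Matrix ι ι ℂ} (hM : M.IsHermitian) :
    M.PosDef ↔ ∀ x : EuclideanSpace ℂ ι, x ≠ 0 → 0 < hform M x := by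
  constructor
  · intro h x hx
    have := h.dotProduct_mulVec_pos (x := x.ofLp) (by simpa using hx)
    exact (Complex.lt_def.mp this).1
  · intro h
    refine Matrix.PosDef.of_dotProduct_mulVec_pos hM fun x hx => ?_
    have h1 := h (WithLp.toLp 2 x) (by simpa using hx)
    have h2 := hM.im_star_dotProduct_mulVec_self x
    exact Complex.lt_def.mpr ⟨h1, h2.symm⟩

end HermitianForm

/-! ### Monotone Z-matrices -/

section ZMatrix

variable {n : Type*} [Fintype n] {A : Matrix n n ℝ} {d : n → ℝ}

theorem pos_of_mulVec_pos (hA : ∀ i j, i ≠ j → A i j ≤ 0) (hd : ∀ i, 0 ≤ d i) {i : n}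
    (hi : 0 < (A *ᵥ d) i) : 0 < d i := by
  refine (hd i).lt_of_ne fun h => hi.not_ge ?_
  refine Finset.sum_nonpos fun j _ => ?_
  rcases eq_or_ne i j with rfl | hij
  · simp [← h]
  · exact mul_nonpos_of_nonpos_of_nonneg (hA i j hij) (hd j)

/-- A Z-matrix which maps some nonnegative vector to a positive one is monotone. -/
theorem nonneg_of_mulVec_nonneg (hA : ∀ i j, i ≠ j → A i j ≤ 0) (hd : ∀ i, 0 ≤ d i)
    (hAd : ∀ i, 0 < (A *ᵥ d) i) {x : n → ℝ} (hx : ∀ i, 0 ≤ (A *ᵥ x) i) (i : n) : 0 ≤ x i := by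
  have hd' i : 0 < d i := pos_of_mulVec_pos hA hd (hAd i)
  -- With t the least ratio x_j / d_j, attained at k, the vector x - t d is nonnegative and vanishes
  -- at k; t < 0 would make its image positive at k.
  obtain ⟨k, -, hk⟩ := Finset.exists_min_image Finset.univ (fun j => x j / d j)
    ⟨i, Finset.mem_univ i⟩
  have key : 0 ≤ x k / d k := by
    by_contra! hneg
    set t := x k / d k
    have hy j : 0 ≤ (x - t • d) j := by
      have := (le_div_iff₀ (hd' j)).mp (hk j (Finset.mem_univ j))
      simpa using this
    have hyk : 0 < (A *ᵥ (x - t • d)) k := by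
      rw [Matrix.mulVec_sub, Matrix.mulVec_smul]
      have := mul_pos_of_neg_of_neg hneg (neg_lt_zero.mpr (hAd k))
      simp only [Pi.sub_apply, Pi.smul_apply, smul_eq_mul]
      linarith [hx k]
    have := pos_of_mulVec_pos hA hy hyk
    simp [t, (hd' k).ne'] at this
  have h := key.trans (hk i (Finset.mem_univ i))
  simpa [(hd' i).ne'] using mul_nonneg h (hd i)

/-- Monotonicity applied to v and -v gives injectivity; applied to the columns of the inverse, it
gives nonnegative entries, a property that survives transposition. -/
theorem exists_nonneg_transpose_mulVec_eq [DecidableEq n] (hA : ∀ i j, i ≠ j → A i j ≤ 0)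
    (hd : ∀ i, 0 ≤ d i) (hAd : ∀ i, 0 < (A *ᵥ d) i) {b : n → ℝ} (hb : ∀ i, 0 ≤ b i) :
    ∃ p : n → ℝ, (∀ i, 0 ≤ p i) ∧ Aᵀ *ᵥ p = b := by
  have hdet : IsUnit A.det := by
    rw [isUnit_iff_ne_zero]
    intro h
    obtain ⟨v, hv, hAv⟩ := Matrix.exists_mulVec_eq_zero_iff.mpr h
    refine hv (funext fun i => le_antisymm ?_ ?_)
    · have := nonneg_of_mulVec_nonneg hA hd hAd (x := -v) (by simp [Matrix.mulVec_neg, hAv]) i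
      simpa using this
    · exact nonneg_of_mulVec_nonneg hA hd hAd (by simp [hAv]) i
  have hinv i j : 0 ≤ A⁻¹ i j := by
    have := nonneg_of_mulVec_nonneg hA hd hAd (x := A⁻¹ *ᵥ Pi.single j 1) (fun k => by
      rw [Matrix.mulVec_mulVec, Matrix.mul_nonsing_inv _ hdet, Matrix.one_mulVec, Pi.single_apply]
      split_ifs <;> simp) i
    simpa using this
  refine ⟨(A⁻¹)ᵀ *ᵥ b, fun i => Finset.sum_nonneg fun j _ => mul_nonneg (hinv j i) (hb j), ?_⟩
  rw [Matrix.mulVec_mulVec, ← Matrix.transpose_mul, Matrix.nonsing_inv_mul _ hdet]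
  simp

end ZMatrix

/-! ### Coefficient matrices of the system -/

namespace System

variable {L Nt K : ℕ} (S : System L Nt K)

theorem α_pos : 0 < S.α :=
  one_div_pos.mpr (sub_pos.mpr (Real.one_lt_rpow one_lt_two S.Cdl_pos))

theorem Γt_pos (k : Fin K) : 0 < S.Γt k := by
  have := one_div_pos.mpr (S.Γ_pos k)
  unfold Γt
  linarith

theorem hform_H (k : Fin K) (x : EuclideanSpace ℂ (Fin L × Fin Nt)) :
    hform (S.H k) x = ‖star (S.h k) ⬝ᵥ x.ofLp‖ ^ 2 :=
  hform_vecMulVec _ _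

theorem hform_H_nonneg (k : Fin K) (x : EuclideanSpace ℂ (Fin L × Fin Nt)) :
    0 ≤ hform (S.H k) x := by
  rw [hform_H]
  positivity

theorem hform_A_nonneg (k : Fin K) (x : EuclideanSpace ℂ (Fin L × Fin Nt)) :
    0 ≤ hform (S.A k) x := by
  rw [A, hform_add, hform_smul, hform_diagonal]
  refine add_nonneg (S.hform_H_nonneg k x) (mul_nonneg S.α_pos.le
    (Finset.sum_nonneg fun i _ => mul_nonneg ?_ (sq_nonneg _)))
  simp only [H, Matrix.diag_apply, Matrix.vecMulVec_apply, Pi.star_apply, RCLike.star_def,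
    Complex.mul_conj, Complex.ofReal_re]
  exact Complex.normSq_nonneg _

theorem hform_C (lam : ℝ) (μ : Fin K → ℝ) (x : EuclideanSpace ℂ (Fin L × Fin Nt)) :
    hform (S.C lam μ) x = ‖x‖ ^ 2 - lam * hform S.B x + ∑ i, μ i * hform (S.A i) x := by
  rw [C, hform_add, hform_sub, hform_one, hform_smul, hform_sum]
  simp only [hform_smul]

theorem isHermitian_H (k : Fin K) : (S.H k).IsHermitian :=
  (Matrix.posSemidef_vecMulVec_self_star _).isHermitian

theorem isHermitian_A (k : Fin K) : (S.A k).IsHermitian := by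
  refine (S.isHermitian_H k).add ?_
  rw [Matrix.IsHermitian, Matrix.conjTranspose_smul, Matrix.diagonal_conjTranspose]
  congr 2
  · funext i
    exact (S.isHermitian_H k).apply i i

theorem isHermitian_B : S.B.IsHermitian := by
  refine Matrix.isHermitian_conjTranspose_mul_mul _
    ((Matrix.posSemidef_vecMulVec_self_star _).isHermitian.add ?_)
  rw [Matrix.IsHermitian, Matrix.conjTranspose_smul, Matrix.conjTranspose_one]
  simp

theorem isHermitian_C (lam : ℝ) (μ : Fin K → ℝ) : (S.C lam μ).IsHermitian := by
  rw [Matrix.IsHermitian, C, Matrix.conjTranspose_add, Matrix.conjTranspose_sub,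
    Matrix.conjTranspose_sum]
  simp only [Matrix.conjTranspose_smul, Matrix.conjTranspose_one, (S.isHermitian_A _).eq,
    S.isHermitian_B.eq, star_trivial]

/-- The matrix `C(λ, μ) - μ_k Γ̃_k H_k`, whose positivity is the `k`-th dual constraint. -/
noncomputable def dualMatrix (lam : ℝ) (μ : Fin K → ℝ) (k : Fin K) :
    Matrix (Fin L × Fin Nt) (Fin L × Fin Nt) ℂ :=
  S.C lam μ - (μ k * S.Γt k) • S.H k

theorem hform_dualMatrix (lam : ℝ) (μ : Fin K → ℝ) (k : Fin K)
    (x : EuclideanSpace ℂ (Fin L × Fin Nt)) :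
    hform (S.dualMatrix lam μ k) x =
      hform (S.C lam μ) x - μ k * (S.Γt k * hform (S.H k) x) := by
  rw [dualMatrix, hform_sub, hform_smul, mul_assoc]

variable {S} in
theorem h_ne_zero {w : Fin K → EuclideanSpace ℂ (Fin L × Fin Nt)} (hw : S.PrimalFeasible w)
    (k : Fin K) : S.h k ≠ 0 := by
  intro h
  have h1 := hw k
  have h2 : 0 ≤ ∑ i, hform (S.A k) (w i) := Finset.sum_nonneg fun i _ => S.hform_A_nonneg k _
  have h3 := pow_pos S.σv_pos 2
  simp only [hform_H, h, star_zero, zero_dotProduct, norm_zero, ne_eq, OfNat.ofNat_ne_zero,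
    not_false_eq_true, zero_pow, mul_zero] at h1
  linarith

variable {S} in
theorem hform_H_pos {w : Fin K → EuclideanSpace ℂ (Fin L × Fin Nt)} (hw : S.PrimalFeasible w)
    (k : Fin K) : 0 < hform (S.H k) (w k) := by
  have h1 := hw k
  have h2 : 0 ≤ ∑ i, hform (S.A k) (w i) := Finset.sum_nonneg fun i _ => S.hform_A_nonneg k _
  have h3 := pow_pos S.σv_pos 2
  exact pos_of_mul_pos_right (lt_of_lt_of_le (by linarith) h1) (S.Γt_pos k).le

/-! ### From Rayleigh quotients to nonnegative forms -/

theorem den_pos {k : Fin K} {x : EuclideanSpace ℂ (Fin L × Fin Nt)} (hx : hform (S.H k) x ≠ 0) :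
    0 < S.Γt k * hform (S.H k) x :=
  mul_pos (S.Γt_pos k) ((S.hform_H_nonneg k x).lt_of_ne' hx)

theorem ne_zero_of_hform_ne_zero {M : Matrix (Fin L × Fin Nt) (Fin L × Fin Nt) ℂ}
    {x : EuclideanSpace ℂ (Fin L × Fin Nt)} (hx : hform M x ≠ 0) : x ≠ 0 := by
  rintro rfl
  exact hx (hform_zero_vec _)

theorem normalize_mem_directions {k : Fin K} {x : EuclideanSpace ℂ (Fin L × Fin Nt)}
    (hx : hform (S.H k) x ≠ 0) : ‖x‖⁻¹ • x ∈ S.directions k := by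
  have h0 := ne_zero_of_hform_ne_zero hx
  refine ⟨by simp [norm_smul, h0], ?_⟩
  rw [hform_real_smul_vec]
  exact mul_ne_zero (by simp [h0]) hx

theorem rayleigh_normalize (lam : ℝ) (μ : Fin K → ℝ) {k : Fin K}
    {x : EuclideanSpace ℂ (Fin L × Fin Nt)} (hx : x ≠ 0) :
    S.rayleigh lam μ k (‖x‖⁻¹ • x) = S.rayleigh lam μ k x := by
  have h0 : (‖x‖⁻¹) ^ 2 ≠ 0 := by simp [hx]
  rw [rayleigh, rayleigh, hform_real_smul_vec, hform_real_smul_vec, mul_left_comm,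
    mul_div_mul_left _ _ h0]

/-- Clearing the positive denominator handles vectors not orthogonal to `h k`. These are dense
because `h k ≠ 0`, so continuity handles the rest. -/
theorem dualFeasible_iff (hh : ∀ k, S.h k ≠ 0) (lam : ℝ) (μ : Fin K → ℝ) :
    S.DualFeasible lam μ ↔
      (∀ k, 0 ≤ μ k) ∧ ∀ k x, 0 ≤ hform (S.dualMatrix lam μ k) x := by
  refine and_congr_right fun _ => forall_congr' fun k => ?_
  constructor
  · intro h
    have main x (hx : hform (S.H k) x ≠ 0) : 0 ≤ hform (S.dualMatrix lam μ k) x := by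
      have h1 := (le_iInf₂_iff.mp h) _ (S.normalize_mem_directions hx)
      rw [S.rayleigh_normalize lam μ (ne_zero_of_hform_ne_zero hx), EReal.coe_le_coe_iff,
        rayleigh, le_div_iff₀ (S.den_pos hx)] at h1
      rw [hform_dualMatrix]
      linarith
    intro x
    by_cases hx : hform (S.H k) x = 0
    -- Moving x by any nonzero multiple of `h k` leaves the hyperplane orthogonal to `h k`.
    · set y : EuclideanSpace ℂ (Fin L × Fin Nt) := WithLp.toLp 2 (S.h k)
      have hx' : star (S.h k) ⬝ᵥ x.ofLp = 0 := by simpa [hform_H] using hx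
      have hlim : Filter.Tendsto (fun t : ℝ => hform (S.dualMatrix lam μ k) (x + t • y))
          (nhdsWithin 0 {0}ᶜ) (nhds (hform (S.dualMatrix lam μ k) x)) := by
        have hc : Continuous fun t : ℝ => hform (S.dualMatrix lam μ k) (x + t • y) :=
          (continuous_hform _).comp (by fun_prop)
        have := hc.tendsto 0
        simp only [zero_smul, add_zero] at this
        exact this.mono_left nhdsWithin_le_nhds
      refine ge_of_tendsto hlim ?_
      filter_upwards [self_mem_nhdsWithin] with t ht
      refine main _ ?_
      have ht : t ≠ 0 := ht
      rw [hform_H]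
      simp [y, dotProduct_add, hx', ht, hh k, dotProduct_smul]
    · exact main x hx
  · intro h
    refine le_iInf₂ fun u hu => ?_
    rw [EReal.coe_le_coe_iff, rayleigh, le_div_iff₀ (S.den_pos hu.2)]
    have := h u
    rw [hform_dualMatrix] at this
    linarith

variable {S} in
theorem DualStrictlyFeasible.dualFeasible {lam : ℝ} {μ : Fin K → ℝ}
    (h : S.DualStrictlyFeasible lam μ) : S.DualFeasible lam μ :=
  ⟨h.1, fun k => (h.2.2 k).le⟩

variable {S} in
theorem DualStrictlyFeasible.hform_pos {lam : ℝ} {μ : Fin K → ℝ}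
    (h : S.DualStrictlyFeasible lam μ) (k : Fin K) {x : EuclideanSpace ℂ (Fin L × Fin Nt)}
    (hx : x ≠ 0) : 0 < hform (S.dualMatrix lam μ k) x := by
  rw [hform_dualMatrix]
  by_cases h0 : hform (S.H k) x = 0
  · rw [h0]
    simpa using (posDef_iff_hform_pos (S.isHermitian_C lam μ)).mp h.2.1 x hx
  · have h1 := (h.2.2 k).trans_le (iInf₂_le _ (S.normalize_mem_directions h0))
    rw [S.rayleigh_normalize lam μ hx, EReal.coe_lt_coe_iff, rayleigh,
      lt_div_iff₀ (S.den_pos h0)] at h1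
    linarith

/-- The Lagrangian identity. -/
theorem primalObj_eq (lam : ℝ) (μ : Fin K → ℝ)
    (w : Fin K → EuclideanSpace ℂ (Fin L × Fin Nt)) :
    S.primalObj lam w = ∑ k, hform (S.dualMatrix lam μ k) (w k) +
      ∑ k, μ k * (S.Γt k * hform (S.H k) (w k) - ∑ i, hform (S.A k) (w i)) := by
  have hswap : ∑ k, ∑ i, μ i * hform (S.A i) (w k) = ∑ k, μ k * ∑ i, hform (S.A k) (w i) := by
    rw [Finset.sum_comm]
    simp only [Finset.mul_sum]
  simp only [primalObj, hform_dualMatrix, hform_C, hform_sub, hform_one, hform_smul, mul_sub,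
    Finset.sum_sub_distrib, Finset.sum_add_distrib, hswap]
  ring

theorem primalObj_eq_dualObj_add (lam : ℝ) (μ : Fin K → ℝ)
    (w : Fin K → EuclideanSpace ℂ (Fin L × Fin Nt)) :
    S.primalObj lam w = S.dualObj μ + ∑ k, hform (S.dualMatrix lam μ k) (w k) +
      ∑ k, μ k * (S.Γt k * hform (S.H k) (w k) - (∑ i, hform (S.A k) (w i) + S.σv ^ 2)) := by
  rw [S.primalObj_eq lam μ, dualObj]
  simp only [mul_sub, mul_add, Finset.sum_sub_distrib, Finset.sum_add_distrib]
  ring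

/-! ### Weak duality and complementary slackness -/

variable {S} {lam : ℝ} {μ ν : Fin K → ℝ} {w : Fin K → EuclideanSpace ℂ (Fin L × Fin Nt)}

theorem PrimalFeasible.sum_mul_nonneg (hw : S.PrimalFeasible w) (hμ : ∀ k, 0 ≤ μ k) :
    0 ≤ ∑ k, μ k *
      (S.Γt k * hform (S.H k) (w k) - (∑ i, hform (S.A k) (w i) + S.σv ^ 2)) :=
  Finset.sum_nonneg fun k _ => mul_nonneg (hμ k) (sub_nonneg.mpr (hw k))

theorem weak_duality (hw : S.PrimalFeasible w) (hμ : S.DualFeasible lam μ) :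
    S.dualObj μ ≤ S.primalObj lam w := by
  have h := (S.dualFeasible_iff (h_ne_zero hw) lam μ).mp hμ
  rw [S.primalObj_eq_dualObj_add lam μ]
  have h1 := hw.sum_mul_nonneg h.1
  have h2 : 0 ≤ ∑ k, hform (S.dualMatrix lam μ k) (w k) :=
    Finset.sum_nonneg fun k _ => h.2 k _
  linarith

/-- The gap is a sum of nonnegative terms, so zero gap kills each of them. -/
theorem hform_dualMatrix_eq_zero (hw : S.PrimalFeasible w) (hμ : S.DualFeasible lam μ)
    (heq : S.primalObj lam w = S.dualObj μ) (k : Fin K) :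
    hform (S.dualMatrix lam μ k) (w k) = 0 := by
  have h := (S.dualFeasible_iff (h_ne_zero hw) lam μ).mp hμ
  rw [S.primalObj_eq_dualObj_add lam μ] at heq
  have h1 := hw.sum_mul_nonneg h.1
  have h2 : ∑ k, hform (S.dualMatrix lam μ k) (w k) = 0 :=
    le_antisymm (by linarith) (Finset.sum_nonneg fun k _ => h.2 k _)
  exact (Finset.sum_eq_zero_iff_of_nonneg fun k _ => h.2 k _).mp h2 k (Finset.mem_univ k)

/-! ### Order and compactness of the dual feasible set -/

theorem continuous_dualObj : Continuous S.dualObj := by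
  unfold dualObj
  fun_prop

theorem dualObj_lt (h : ∀ k, μ k ≤ ν k) {k : Fin K} (hk : μ k < ν k) :
    S.dualObj μ < S.dualObj ν :=
  Finset.sum_lt_sum (fun k _ => mul_le_mul_of_nonneg_right (h k) (sq_nonneg _))
    ⟨k, Finset.mem_univ k, mul_lt_mul_of_pos_right hk (pow_pos S.σv_pos 2)⟩

theorem hform_C_mono (lam : ℝ) (h : ∀ k, μ k ≤ ν k) (x : EuclideanSpace ℂ (Fin L × Fin Nt)) :
    hform (S.C lam μ) x ≤ hform (S.C lam ν) x := by
  rw [hform_C, hform_C]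
  gcongr with i
  · exact S.hform_A_nonneg i x
  · exact h i

/-- The dual feasible set is closed under pointwise maxima. -/
theorem dualFeasible_sup (hh : ∀ k, S.h k ≠ 0) (hμ : S.DualFeasible lam μ)
    (hν : S.DualFeasible lam ν) : S.DualFeasible lam (μ ⊔ ν) := by
  rw [S.dualFeasible_iff hh] at *
  refine ⟨fun k => (hμ.1 k).trans (le_max_left _ _), fun k x => ?_⟩
  rw [hform_dualMatrix]
  rcases max_cases (μ k) (ν k) with ⟨h, -⟩ | ⟨h, -⟩
  · have h1 := hμ.2 k x
    have h2 := S.hform_C_mono lam (μ := μ) (ν := μ ⊔ ν) (fun k => le_max_left _ _) x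
    rw [hform_dualMatrix] at h1
    rw [Pi.sup_apply, h]
    linarith
  · have h1 := hν.2 k x
    have h2 := S.hform_C_mono lam (μ := ν) (ν := μ ⊔ ν) (fun k => le_max_right _ _) x
    rw [hform_dualMatrix] at h1
    rw [Pi.sup_apply, h]
    linarith

/-- Otherwise the maximum of the two points would be feasible with a larger objective. -/
theorem IsDualOptimal.le (hh : ∀ k, S.h k ≠ 0) (hμ : S.IsDualOptimal lam μ)
    (hν : S.DualFeasible lam ν) (k : Fin K) : ν k ≤ μ k := by
  by_contra! h
  have h1 := hμ.2 _ (dualFeasible_sup hh hμ.1 hν)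
  refine h1.not_gt (dualObj_lt (fun k => le_max_left _ _) (k := k) ?_)
  exact lt_max_of_lt_right h

/-- Closedness is joint in λ and μ because strong duality passes to a limit in both. -/
theorem isClosed_setOf_dualFeasible (hh : ∀ k, S.h k ≠ 0) :
    IsClosed {p : ℝ × (Fin K → ℝ) | S.DualFeasible p.1 p.2} := by
  simp only [S.dualFeasible_iff hh, hform_dualMatrix, hform_C, Set.ofPred_and, Set.ofPred_forall]
  refine (isClosed_iInter fun k => isClosed_le (by fun_prop) (by fun_prop)).inter
    (isClosed_iInter fun k => isClosed_iInter fun x => isClosed_le (by fun_prop) (by fun_prop))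

theorem mem_Icc_of_dualFeasible {c : ℝ} (hμ : S.DualFeasible lam μ) (hc : S.dualObj μ ≤ c) :
    μ ∈ Set.Icc (0 : Fin K → ℝ) (fun _ => c / S.σv ^ 2) := by
  refine ⟨hμ.1, fun k => ?_⟩
  rw [le_div_iff₀ (pow_pos S.σv_pos 2)]
  exact (Finset.single_le_sum (f := fun k => μ k * S.σv ^ 2)
    (fun k _ => mul_nonneg (hμ.1 k) (sq_nonneg _)) (Finset.mem_univ k)).trans hc

theorem exists_isDualOptimal (hw : S.PrimalFeasible w) (hμ : S.DualFeasible lam μ) :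
    ∃ μ, S.IsDualOptimal lam μ := by
  have hcl : IsClosed {μ | S.DualFeasible lam μ} :=
    (isClosed_setOf_dualFeasible (h_ne_zero hw)).preimage (Continuous.prodMk_right lam)
  have hcomp : IsCompact {μ | S.DualFeasible lam μ} :=
    (isCompact_Icc (a := (0 : Fin K → ℝ))).of_isClosed_subset hcl fun μ hμ =>
      mem_Icc_of_dualFeasible hμ (weak_duality hw hμ)
  obtain ⟨μ', h1, h2⟩ := hcomp.exists_isMaxOn ⟨μ, hμ⟩ continuous_dualObj.continuousOn
  exact ⟨μ', h1, fun ν hν => h2 hν⟩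

/-- At a dual optimum no constraint matrix is positive definite. -/
theorem IsDualOptimal.exists_hform_eq_zero (hh : ∀ k, S.h k ≠ 0) (hμ : S.IsDualOptimal lam μ)
    (k : Fin K) : ∃ x, x ≠ 0 ∧ hform (S.dualMatrix lam μ k) x = 0 := by
  have hf := (S.dualFeasible_iff hh lam μ).mp hμ.1
  by_contra! hne
  obtain ⟨ε, hε, hle⟩ := exists_le_hform (M := S.dualMatrix lam μ k)
    fun x hx => (hf.2 k x).lt_of_ne' (hne x hx)
  obtain ⟨c, hc, hHle⟩ := exists_hform_le (S.H k)
  have hΓ := S.Γt_pos k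
  -- Small enough that raising μ_k by δ costs at most the margin ε; the 1 keeps the denominator
  -- positive when c = 0.
  set δ := ε / (S.Γt k * c + 1)
  have hδ : 0 < δ := by positivity
  have hδc : δ * (S.Γt k * c) ≤ ε := by
    rw [div_mul_eq_mul_div, div_le_iff₀ (by positivity)]
    nlinarith
  set ν := Function.update μ k (μ k + δ)
  have hνk : ν k = μ k + δ := Function.update_self ..
  have hμν i : μ i ≤ ν i := by
    rcases eq_or_ne i k with rfl | hi
    · linarith
    · exact (Function.update_of_ne hi ..).ge
  have hν : S.DualFeasible lam ν := by
    rw [S.dualFeasible_iff hh]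
    refine ⟨fun i => (hf.1 i).trans (hμν i), fun i x => ?_⟩
    have h1 := S.hform_C_mono lam hμν x
    rcases eq_or_ne i k with rfl | hi
    · have h2 := hle x
      rw [hform_dualMatrix] at h2 ⊢
      have h3 : δ * (S.Γt i * hform (S.H i) x) ≤ ε * ‖x‖ ^ 2 := calc
        _ ≤ δ * (S.Γt i * (c * ‖x‖ ^ 2)) := by gcongr; exact hHle x
        _ = δ * (S.Γt i * c) * ‖x‖ ^ 2 := by ring
        _ ≤ _ := by gcongr
      rw [hνk]
      linarith
    · have h2 := hf.2 i x
      rw [hform_dualMatrix] at h2 ⊢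
      rw [show ν i = μ i from Function.update_of_ne hi ..]
      linarith
  exact (hμ.2 ν hν).not_gt (dualObj_lt hμν (k := k) (by linarith))

/-- If all the constraint matrices of some dual feasible point are positive definite, then the
optimal value of the dual problem is attained in the primal problem. -/
theorem exists_primalFeasible_eq (hh : ∀ k, S.h k ≠ 0) (hν : S.DualFeasible lam ν)
    (hpos : ∀ k x, x ≠ 0 → 0 < hform (S.dualMatrix lam ν k) x) (hμ : S.IsDualOptimal lam μ) :
    ∃ w, S.PrimalFeasible w ∧ S.primalObj lam w = S.dualObj μ := by
  choose u hu0 hu using hμ.exists_hform_eq_zero hh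
  -- Row k of G collects the μ-dependent part of -M_k at u_k; its transpose governs the SINR
  -- equations in the powers.
  set G : Matrix (Fin K) (Fin K) ℝ :=
    Matrix.diagonal (fun k => S.Γt k * hform (S.H k) (u k)) -
      Matrix.of fun k i => hform (S.A i) (u k) with hGdef
  have hG (η : Fin K → ℝ) k : (G *ᵥ η) k =
      η k * (S.Γt k * hform (S.H k) (u k)) - ∑ i, η i * hform (S.A i) (u k) := by
    rw [hGdef, Matrix.sub_mulVec, Pi.sub_apply, Matrix.mulVec_diagonal, mul_comm]
    simp [Matrix.mulVec, dotProduct, mul_comm]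
  have hoff k i (hki : k ≠ i) : G k i ≤ 0 := by
    simp [G, hki, S.hform_A_nonneg]
  have hd i : 0 ≤ (μ - ν) i := sub_nonneg.mpr (hμ.le hh hν i)
  -- The terms free of μ cancel, so this entry is the form of M_k(ν) at u_k minus that of M_k(μ),
  -- which is zero.
  have hGd k : 0 < (G *ᵥ (μ - ν)) k := by
    have h1 := hpos k _ (hu0 k)
    have h2 := hu k
    rw [hform_dualMatrix, hform_C] at h1 h2
    rw [Matrix.mulVec_sub, Pi.sub_apply, hG, hG]
    linarith
  obtain ⟨p, hp, hGp⟩ := exists_nonneg_transpose_mulVec_eq hoff hd hGd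
    (b := fun _ => S.σv ^ 2) (fun _ => sq_nonneg _)
  set w : Fin K → EuclideanSpace ℂ (Fin L × Fin Nt) := fun k => Real.sqrt (p k) • u k
  have hform_w M k : hform M (w k) = p k * hform M (u k) := by
    simp only [w]
    rw [hform_real_smul_vec, Real.sq_sqrt (hp k)]
  have hw k : S.Γt k * hform (S.H k) (w k) = ∑ i, hform (S.A k) (w i) + S.σv ^ 2 := by
    have h1 := congrFun hGp k
    rw [hGdef, Matrix.transpose_sub, Matrix.diagonal_transpose, Matrix.sub_mulVec, Pi.sub_apply,
      Matrix.mulVec_diagonal] at h1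
    simp only [Matrix.mulVec, dotProduct, Matrix.transpose_apply, Matrix.of_apply] at h1
    simp only [hform_w, mul_comm (p _)]
    linarith
  refine ⟨w, fun k => (hw k).ge, ?_⟩
  -- Every slack is zero and every M_k vanishes at w_k, so nothing remains of the gap.
  rw [S.primalObj_eq_dualObj_add lam μ]
  simp only [hw, sub_self, mul_zero, Finset.sum_const_zero, add_zero]
  simp [hform_w, hu]

theorem isPrimalOptimal_of_eq (hw : S.PrimalFeasible w) (hμ : S.DualFeasible lam μ)
    (heq : S.primalObj lam w = S.dualObj μ) : S.IsPrimalOptimal lam w :=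
  ⟨hw, fun _ hw' => heq.trans_le (weak_duality hw' hμ)⟩

/-! ### Strong duality by shrinking λ -/

theorem hform_C_mul_smul (lam s : ℝ) (μ : Fin K → ℝ) (x : EuclideanSpace ℂ (Fin L × Fin Nt)) :
    hform (S.C (s * lam) (s • μ)) x = (1 - s) * ‖x‖ ^ 2 + s * hform (S.C lam μ) x := by
  simp only [hform_C, Pi.smul_apply, smul_eq_mul, mul_add, Finset.mul_sum, mul_assoc]
  ring

theorem hform_dualMatrix_mul_smul (lam s : ℝ) (μ : Fin K → ℝ) (k : Fin K)
    (x : EuclideanSpace ℂ (Fin L × Fin Nt)) :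
    hform (S.dualMatrix (s * lam) (s • μ) k) x =
      (1 - s) * ‖x‖ ^ 2 + s * hform (S.dualMatrix lam μ k) x := by
  rw [hform_dualMatrix, hform_dualMatrix, hform_C_mul_smul, Pi.smul_apply, smul_eq_mul]
  ring

theorem primalObj_mul (lam s : ℝ) (w : Fin K → EuclideanSpace ℂ (Fin L × Fin Nt)) :
    S.primalObj (s * lam) w = (1 - s) * ∑ k, ‖w k‖ ^ 2 + s * S.primalObj lam w := by
  simp only [primalObj, Finset.mul_sum, ← Finset.sum_add_distrib]
  refine Finset.sum_congr rfl fun k _ => ?_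
  simp only [hform_sub, hform_one, hform_smul]
  ring

/-- For `s < 1`, the problems with parameter `s * lam` have a common optimal value. -/
theorem exists_optimal_pair_mul (hP : ∃ w, S.PrimalFeasible w) (hμ : S.DualFeasible lam μ) {s : ℝ}
    (hs0 : 0 ≤ s) (hs1 : s < 1) :
    ∃ w ν, S.PrimalFeasible w ∧ S.DualFeasible (s * lam) ν ∧
      S.primalObj (s * lam) w = S.dualObj ν := by
  obtain ⟨w₀, hw₀⟩ := hP
  have hh := h_ne_zero hw₀
  have hf := (S.dualFeasible_iff hh lam μ).mp hμ
  have hpos k x (hx : x ≠ 0) : 0 < hform (S.dualMatrix (s * lam) (s • μ) k) x := by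
    have h1 : 0 < (1 - s) * ‖x‖ ^ 2 := mul_pos (sub_pos.mpr hs1) (by positivity)
    have h2 := mul_nonneg hs0 (hf.2 k x)
    rw [hform_dualMatrix_mul_smul]
    linarith
  have hfeas : S.DualFeasible (s * lam) (s • μ) := by
    rw [S.dualFeasible_iff hh]
    refine ⟨fun k => mul_nonneg hs0 (hf.1 k), fun k x => ?_⟩
    rcases eq_or_ne x 0 with rfl | hx
    · rw [hform_zero_vec]
    · exact (hpos k x hx).le
  obtain ⟨ν, hν⟩ := exists_isDualOptimal hw₀ hfeas
  obtain ⟨w, hw, heq⟩ := exists_primalFeasible_eq hh hfeas hpos hν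
  exact ⟨w, ν, hw, hν.1, heq⟩

theorem strong_duality (hP : ∃ w, S.PrimalFeasible w) (hμ : S.IsDualOptimal lam μ) :
    IsGLB (S.primalObj lam '' {w | S.PrimalFeasible w}) (S.dualObj μ) := by
  refine ⟨?_, fun v hv => ?_⟩
  · rintro _ ⟨w, hw, rfl⟩
    exact weak_duality hw hμ.1
  obtain ⟨w₀, hw₀⟩ := id hP
  have hh := h_ne_zero hw₀
  obtain ⟨s, -, hs, hslim⟩ := exists_seq_strictMono_tendsto' (zero_lt_one (α := ℝ))
  choose w ν hw hν heq using fun n => exists_optimal_pair_mul hP hμ.1 (hs n).1.le (hs n).2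
  -- Testing against the fixed feasible `w₀` bounds the dual values uniformly in n, so the
  -- multipliers stay in one compact box.
  have hbound n : S.dualObj (ν n) ≤ ∑ k, ‖w₀ k‖ ^ 2 + |S.primalObj lam w₀| := by
    refine (weak_duality hw₀ (hν n)).trans ?_
    rw [primalObj_mul]
    have h1 : 0 ≤ ∑ k, ‖w₀ k‖ ^ 2 := Finset.sum_nonneg fun k _ => sq_nonneg _
    have h2 := mul_le_mul_of_nonneg_left (le_abs_self (S.primalObj lam w₀)) (hs n).1.le
    nlinarith [(hs n).1, (hs n).2, abs_nonneg (S.primalObj lam w₀)]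
  obtain ⟨ν', -, φ, hφ, hlim⟩ := isCompact_Icc.tendsto_subseq
    fun n => mem_Icc_of_dualFeasible (hν n) (hbound n)
  have hslim' := hslim.comp hφ.tendsto_atTop
  have hν' : S.DualFeasible lam ν' := by
    have h1 : Filter.Tendsto (fun n => (s (φ n) * lam, ν (φ n))) Filter.atTop
        (nhds (lam, ν')) := by
      simpa using (hslim'.mul_const lam).prodMk_nhds hlim
    exact (isClosed_setOf_dualFeasible hh).mem_of_tendsto h1 (Filter.Eventually.of_forall
      fun n => hν (φ n))
  refine le_trans ?_ (hμ.2 ν' hν')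
  have h1 : Filter.Tendsto (fun n => s (φ n) * v) Filter.atTop (nhds v) := by
    simpa using hslim'.mul_const v
  -- The perturbed objective is at least s times the original one, so each perturbed dual value is
  -- at least s v.
  refine le_of_tendsto_of_tendsto' h1 ((continuous_dualObj.tendsto ν').comp hlim) fun n => ?_
  have h2 : v ≤ S.primalObj lam (w (φ n)) := hv ⟨_, hw _, rfl⟩
  have h3 : 0 ≤ ∑ k, ‖w (φ n) k‖ ^ 2 := Finset.sum_nonneg fun k _ => sq_nonneg _
  have h4 := heq (φ n)
  rw [primalObj_mul] at h4
  have h5 := mul_le_mul_of_nonneg_left h2 (hs (φ n)).1.le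
  have h6 := mul_nonneg (sub_nonneg.mpr (hs (φ n)).2.le) h3
  simp only [Function.comp_apply]
  linarith

/-! ### Optimal directions and powers -/

theorem IsPrimalOptimal.eq_dualObj (hw : S.IsPrimalOptimal lam w) (hμ : S.IsDualOptimal lam μ) :
    S.primalObj lam w = S.dualObj μ := by
  refine le_antisymm ((strong_duality ⟨w, hw.1⟩ hμ).2 ?_) (weak_duality hw.1 hμ.1)
  rintro _ ⟨w', hw', rfl⟩
  exact hw.2 w' hw'

theorem IsPrimalOptimal.isMinDirection (hw : S.IsPrimalOptimal lam w)
    (hμ : S.IsDualOptimal lam μ) (k : Fin K) :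
    w k ≠ 0 ∧ S.IsMinDirection lam μ k (‖w k‖⁻¹ • w k) ∧
      (μ k : EReal) = S.minRayleigh lam μ k := by
  have hH := hform_H_pos hw.1 k
  have h0 : w k ≠ 0 := ne_zero_of_hform_ne_zero hH.ne'
  have hmem := S.normalize_mem_directions hH.ne'
  have hz := hform_dualMatrix_eq_zero hw.1 hμ.1 (hw.eq_dualObj hμ) k
  have hr : S.rayleigh lam μ k (‖w k‖⁻¹ • w k) = μ k := by
    rw [S.rayleigh_normalize lam μ h0, rayleigh, div_eq_iff (S.den_pos hH.ne').ne']
    rw [hform_dualMatrix] at hz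
    linarith
  have heq : (μ k : EReal) = S.minRayleigh lam μ k := by
    refine le_antisymm (hμ.1.2 k) ?_
    rw [← hr]
    exact iInf₂_le _ hmem
  exact ⟨h0, ⟨hmem, by rw [hr, heq]⟩, heq⟩

/-- If `C(λ, μ)` is positive definite, then the zeros of the form of a constraint matrix of a
dual feasible point are determined up to scaling. -/
theorem exists_eq_smul (hh : ∀ k, S.h k ≠ 0) (hμ : S.DualFeasible lam μ)
    (hC : (S.C lam μ).PosDef) {k : Fin K} {u x : EuclideanSpace ℂ (Fin L × Fin Nt)}
    (hu : hform (S.dualMatrix lam μ k) u = 0) (hx : hform (S.dualMatrix lam μ k) x = 0)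
    (hHu : hform (S.H k) u ≠ 0) : ∃ c : ℂ, x = c • u := by
  have hf := (S.dualFeasible_iff hh lam μ).mp hμ
  have hne : star (S.h k) ⬝ᵥ u.ofLp ≠ 0 := by simpa [hform_H] using hHu
  -- This c makes x - c u orthogonal to `h k`. There the M_k form reduces to that of C, whose
  -- definiteness forces x = c u.
  set c : ℂ := (star (S.h k) ⬝ᵥ x.ofLp) / (star (S.h k) ⬝ᵥ u.ofLp) with hc
  have hz : hform (S.dualMatrix lam μ k) (x + (-c) • u) = 0 :=
    hform_add_eq_zero (hf.2 k) hx (by rw [hform_smul_vec, hu, mul_zero])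
  have hHz : hform (S.H k) (x + (-c) • u) = 0 := by
    rw [hform_H]
    simp [dotProduct_add, dotProduct_smul, hc, hne]
  rw [hform_dualMatrix, hHz, mul_zero, mul_zero, sub_zero] at hz
  refine ⟨c, ?_⟩
  by_contra hxc
  refine ((posDef_iff_hform_pos (S.isHermitian_C lam μ)).mp hC _ fun h => hxc ?_).ne' hz
  rwa [neg_smul, ← sub_eq_add_neg, sub_eq_zero] at h

theorem IsPrimalOptimal.exists_powers (hw : S.IsPrimalOptimal lam w)
    (hμ : S.IsDualOptimal lam μ) (hC : (S.C lam μ).PosDef)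
    {u : Fin K → EuclideanSpace ℂ (Fin L × Fin Nt)}
    (hu : ∀ k, S.IsMinDirection lam μ k (u k)) :
    ∃ p : Fin K → ℝ, (∀ k, 0 < p k) ∧
      S.IsPrimalOptimal lam (fun k => Real.sqrt (p k) • u k) := by
  have hzu k : hform (S.dualMatrix lam μ k) (u k) = 0 := by
    have h1 := (hu k).2.trans (hw.isMinDirection hμ k).2.2.symm
    rw [EReal.coe_eq_coe_iff, rayleigh, div_eq_iff (S.den_pos (hu k).1.2).ne'] at h1
    rw [hform_dualMatrix, h1, sub_self]
  choose c hc using fun k => exists_eq_smul (h_ne_zero hw.1) hμ.1 hC (hzu k)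
    (hform_dualMatrix_eq_zero hw.1 hμ.1 (hw.eq_dualObj hμ) k) (hu k).1.2
  -- The phase of c is invisible to every form, so the power |c|² reproduces all values at w_k.
  have hform_eq M k : hform M (Real.sqrt (‖c k‖ ^ 2) • u k) = hform M (w k) := by
    rw [hform_real_smul_vec, Real.sq_sqrt (sq_nonneg _), hc k, hform_smul_vec]
  refine ⟨fun k => ‖c k‖ ^ 2, fun k => ?_, fun k => ?_, fun w' hw' => ?_⟩
  · have h0 : c k ≠ 0 := fun h => (hw.isMinDirection hμ k).1 (by rw [hc k, h, zero_smul])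
    positivity
  · simp only [hform_eq]
    exact hw.1 k
  · refine le_trans (le_of_eq ?_) (hw.2 w' hw')
    simp only [primalObj, hform_eq]

/-- The optimum dominates ν, and C is increasing in the multipliers. -/
theorem DualStrictlyFeasible.posDef (hh : ∀ k, S.h k ≠ 0) (hν : S.DualStrictlyFeasible lam ν)
    (hμ : S.IsDualOptimal lam μ) : (S.C lam μ).PosDef := by
  rw [posDef_iff_hform_pos (S.isHermitian_C lam μ)]
  intro x hx
  exact ((posDef_iff_hform_pos (S.isHermitian_C lam ν)).mp hν.2.1 x hx).trans_le
    (hform_C_mono lam (hμ.le hh hν.dualFeasible) x)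

end System

end ISAC

theorem proposition3 {L Nt K : ℕ} (S : ISAC.System L Nt K) (lam : ℝ) (hlam : 0 ≤ lam)
    (hP : ∃ w, S.PrimalFeasible w) (hD : ∃ μ, S.DualFeasible lam μ) :
    -- equal optimal values, the dual one being attained
    (∃ v : ℝ, IsGLB (S.primalObj lam '' {w | S.PrimalFeasible w}) v ∧
      IsGreatest (S.dualObj '' {μ | S.DualFeasible lam μ}) v) ∧
    -- the optimal directions attain the minima in the constraints of the dual problem
    (∀ w μ, S.IsPrimalOptimal lam w → S.IsDualOptimal lam μ →
      ∀ k, w k ≠ 0 ∧ S.IsMinDirection lam μ k (‖w k‖⁻¹ • w k) ∧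
        (μ k : EReal) = S.minRayleigh lam μ k) ∧
    -- conversely, all minimizing directions are optimal directions
    (∀ μ, (∃ w, S.IsPrimalOptimal lam w) → S.IsDualOptimal lam μ → (S.C lam μ).PosDef →
      ∀ u : Fin K → EuclideanSpace ℂ (Fin L × Fin Nt),
        (∀ k, S.IsMinDirection lam μ k (u k)) →
        ∃ p : Fin K → ℝ, (∀ k, 0 < p k) ∧
          S.IsPrimalOptimal lam (fun k => Real.sqrt (p k) • u k)) ∧
    -- both conditions just used hold as soon as the dual problem is strictly feasible
    ((∃ μ, S.DualStrictlyFeasible lam μ) →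
      (∃ w, S.IsPrimalOptimal lam w) ∧
        ∀ μ, S.IsDualOptimal lam μ → (S.C lam μ).PosDef) := by
  obtain ⟨w₀, hw₀⟩ := id hP
  have hh := ISAC.System.h_ne_zero hw₀
  obtain ⟨μ₀, hμ₀⟩ := hD
  obtain ⟨μ', hμ'⟩ := ISAC.System.exists_isDualOptimal hw₀ hμ₀
  refine ⟨⟨S.dualObj μ', ISAC.System.strong_duality hP hμ', ⟨μ', hμ'.1, rfl⟩, ?_⟩,
    fun w μ hw hμ k => hw.isMinDirection hμ k, ?_, ?_⟩
  · rintro _ ⟨ν, hν, rfl⟩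
    exact hμ'.2 ν hν
  · rintro μ ⟨w, hw⟩ hμ hC u hu
    exact hw.exists_powers hμ hC hu
  · rintro ⟨ν, hν⟩
    obtain ⟨w, hw, heq⟩ := ISAC.System.exists_primalFeasible_eq hh hν.dualFeasible
      (fun k x hx => hν.hform_pos k hx) hμ'
    exact ⟨⟨w, ISAC.System.isPrimalOptimal_of_eq hw hμ'.1 heq⟩, fun μ hμ => hν.posDef hh hμ⟩
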